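/- A *computing-with-the-cloud (CWC) system* $G=(V,E,w)$ consists of a finite non-empty set $V_p$ of $n$ processing nodes and one cloud node $v_c$. There are local links between processing nodes and cloud links between processing nodes and $v_c$, and each link $e$ has a bandwidth $w(e)\in\mathbb N$, the number of bits that it can carry in one round. Let $G_p$ be the graph of the processing nodes and the local links, with the hop metric. Computation is synchronous. The system $G$ is known to all nodes and local computation is free. In each round a processing node sends on each of its local links a message of at most as many bits as the link's bandwidth, and writes bits to, and reads bits from, files stored at $v_c$, at most $w(i,v_c)$ and $w(v_c,i)$ bits respectively for node $i$. The cloud node is passive. The positions accessed in a round are fixed in advance, independently of the inputs, and no position is written by two nodes in the same round. The system is *$s$-fat-links* if all links are symmetric (in both directions present, with equal bandwidths) and every local link has bandwidth at least $s$. In the problem $\mathsf{cComb}$, each processing node $i$ has an input string $S_i\in\{0,1\}^s$, and for a given associative operator $\otimes:\{0,1\}^s\times\{0,1\}^s\to\{0,1\}^s$ the combination $\bigotimes_{i\in V_p}S_i$ of all the inputs has to be written to a file in the cloud. Let $b_c(i)=w(i,v_c)$ and $b_c(B)=\sum_{i\in B}b_c(i)$ for $B\subseteq V_p$, let $B_r(i)$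 be the set of processing nodes at most $r$ hops away from $i$ in $G_p$, and let $$k_i=\min\bigl(\{\mathrm{diam}(G_p)\}\cup\{k\in\mathbb N : (k+1)\,b_c(B_k(i))\ge s\}\bigr),\qquad B_i=B_{k_i}(i),\qquad Z_i=k_i+\frac{s}{b_c(B_i)},\qquad Z_{\max}=\max_{i\in V_p}Z_i ,$$ where $\mathrm{diam}(G_p)=\infty$ if $G_p$ is disconnected (and $Z_i=0$ if $s=0$). **Theorem.** There is an absolute constant $C>0$ such that the following holds. Let $G$ be an $s$-fat-links CWC system with $n\ge1$ processing nodes, in which every processing node is connected in $G_p$ to some processing node $j$ (possibly itself) with $b_c(j)>0$. Let $\otimes$ be a commutative and associative operator on $\{0,1\}^s$. Then there is an algorithm that solves $\mathsf{cComb}$ with operator $\otimes$, for all inputs and whatever the initial contents of the cloud, within $$C\cdot\max\{1,Z_{\max}\}\cdot\max\{1,\log_2 n\}^2$$ rounds. In particular, $\mathsf{cComb}$ is solved in $O(Z_{\max}\log^2 n)$ rounds whenever $n\ge2$ and $Z_{\max}\ge1$. -/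

import Mathlib

universe u

namespace CloudComputing

/-- Strings of `m` bits. -/
abbrev Bits (m : ℕ) : Type := Fin m → Bool

/-- A cell of the cloud storage: a file name together with a bit position in that file. -/
abbrev Cell : Type := ℕ × ℕ

/-- A computing-with-the-cloud system `G = (V, E, w)` with processing nodes `V` and a single cloud
node.  Links are directed; bandwidths count the bits that can traverse a link in one round. -/
structure CWC (V : Type u) where
  /-- `Link i j`: there is a local link from `i` to `j`. -/
  Link : V → V → Prop
  /-- Bandwidth of the local link from `i` to `j` (irrelevant if there is no such link). -/
  w : V → V → ℕ
  /-- Bandwidth of the link from `i` to the cloud node (`0` if there is no such link). -/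
  up : V → ℕ
  /-- Bandwidth of the link from the cloud node to `i` (`0` if there is no such link). -/
  down : V → ℕ

namespace CWC

variable {V : Type u}

/-- The `s`-fat-links condition: all links are symmetric, and all local links have bandwidth at
least `s`. -/
structure FatLinks (G : CWC V) (s : ℕ) : Prop where
  link_symm : ∀ i j, G.Link i j → G.Link j i
  w_symm : ∀ i j, G.Link i j → G.w i j = G.w j i
  cloud_symm : ∀ i, G.up i = G.down i
  fat : ∀ i j, G.Link i j → s ≤ G.w i j

/-- The graph `G_p` of the processing nodes and the local links, without orientation. -/
def localGraph (G : CWC V) : SimpleGraph V := SimpleGraph.fromRel G.Link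

/-- Every processing node can reach the cloud node, possibly through other processing nodes. -/
def CloudReachable (G : CWC V) : Prop :=
  ∀ i, ∃ j, G.localGraph.Reachable i j ∧ 0 < G.up j

section Timespan

variable [Fintype V]

open Classical in
/-- The ball of radius `r` around `i` in `G_p`, in the hop metric. -/
noncomputable def ball (G : CWC V) (i : V) (r : ℕ) : Finset V :=
  Finset.univ.filter fun j => G.localGraph.edist i j ≤ (r : ℕ∞)

/-- The cloud bandwidth of a set of processing nodes. -/
def cloudBandwidth (G : CWC V) (B : Finset V) : ℕ := ∑ j ∈ B, G.up j

/-- The `s`-cloud radius of node `i`, the minimum of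
`{Diam(G_p)} ∪ {k | (k + 1) * b_c(ball of radius k around i) ≥ s}`.
If `G_p` is disconnected, its diameter is infinite and never attains the minimum. -/
noncomputable def cloudRadius (G : CWC V) (s : ℕ) (i : V) : ℕ :=
  sInf ({k : ℕ | (k : ℕ∞) = G.localGraph.ediam} ∪
    {k : ℕ | s ≤ (k + 1) * G.cloudBandwidth (G.ball i k)})

/-- The `s`-cloud cluster of node `i`. -/
noncomputable def cloudCluster (G : CWC V) (s : ℕ) (i : V) : Finset V :=
  G.ball i (G.cloudRadius s i)

/-- The timespan `Z_i` of the `s`-cloud cluster of node `i`. -/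
noncomputable def timespan (G : CWC V) (s : ℕ) (i : V) : ℝ :=
  (G.cloudRadius s i : ℝ) + (s : ℝ) / (G.cloudBandwidth (G.cloudCluster s i) : ℝ)

/-- The maximal timespan `Z_max` of the system (a maximum over the finitely many nodes). -/
noncomputable def maxTimespan (G : CWC V) (s : ℕ) : ℝ := ⨆ i, G.timespan s i

end Timespan

end CWC

/-- A synchronous distributed algorithm on the system `G`, in which every processing node holds an
`s`-bit input.  The algorithm is designed for a known `G`, and local computation is free.
In round `t`, node `i`
* sends on each outgoing local link a message of as many bits as the link's bandwidth,
* writes cloud cells and reads cloud cells, at most as many as the bandwidths of its links to and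
  from the cloud node allow,
* and then moves to a new state.
The cloud node is passive: it only stores and returns bits.  The cells accessed in a round are
fixed in advance (they depend on the node and the round, not on the inputs), so that all of the
information exchanged with the cloud is in the bits counted against the bandwidth. -/
structure Algorithm {V : Type u} (G : CWC V) (s : ℕ) where
  /-- Local states of the processing nodes. -/
  State : Type u
  /-- Initial state of a node, given its input. -/
  init : V → Bits s → State
  /-- `send t i j σ`: the message that `i`, in state `σ`, sends on the link to `j` in round `t`. -/
  send : ℕ → (i j : V) → State → Bits (G.w i j)
  /-- Cells that are read by a node in a round. -/
  readCells : ℕ → V → Finset Cell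
  /-- Cells that are written by a node in a round. -/
  writeCells : ℕ → V → Finset Cell
  /-- `writeValue t i σ c`: the bit that `i`, in state `σ`, writes to the cell `c` in round `t`. -/
  writeValue : ℕ → V → State → Cell → Bool
  /-- New state of node `i` after round `t`, given its old state, the messages received on the
  incoming local links, and the bits read from the cloud. -/
  step : (t : ℕ) → (i : V) → State → ((j : V) → G.Link j i → Bits (G.w j i)) →
    ((c : Cell) → c ∈ readCells t i → Bool) → State
  card_readCells_le : ∀ t i, (readCells t i).card ≤ G.down i
  card_writeCells_le : ∀ t i, (writeCells t i).card ≤ G.up i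
  /-- No cell is written by two nodes in the same round. -/
  exclusive_write : ∀ t i j c, c ∈ writeCells t i → c ∈ writeCells t j → i = j

namespace Algorithm

variable {V : Type u} {G : CWC V} {s : ℕ}

/-- A global configuration: the states of the processing nodes and the contents of the cloud. -/
structure Config (A : Algorithm G s) where
  state : V → A.State
  cloud : Cell → Bool

open Classical in
/-- The effect of round `t`.  Reads return the contents of the cloud before the round. -/
noncomputable def next (A : Algorithm G s) (t : ℕ) (K : A.Config) : A.Config where
  state i := A.step t i (K.state i) (fun j _ => A.send t j i (K.state j)) (fun c _ => K.cloud c)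
  cloud c :=
    if h : ∃ i, c ∈ A.writeCells t i then A.writeValue t h.choose (K.state h.choose) c
    else K.cloud c

/-- The configuration after `T` rounds, on the inputs `S`, with initial cloud contents `M`. -/
noncomputable def run (A : Algorithm G s) (S : V → Bits s) (M : Cell → Bool) : ℕ → A.Config
  | 0 => ⟨fun i => A.init i (S i), M⟩
  | T + 1 => A.next T (A.run S M T)

end Algorithm

open Classical in
/-- The combination of all the inputs `S i` under an associative and commutative operator `op`
(which need not have a unit, and for which the order of the nodes does not matter). -/
noncomputable def combination {V : Type u} [Fintype V] [Nonempty V] {s : ℕ}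
    (op : Bits s → Bits s → Bits s) [Std.Commutative op] [Std.Associative op]
    (S : V → Bits s) : Bits s :=
  (Finset.univ.erase (Classical.arbitrary V)).fold op (S (Classical.arbitrary V)) S

/-- The algorithm solves `cComb` with operator `op` in `T` rounds: for all inputs, and whatever
the cloud stores initially, after `T` rounds the first `s` bits of the cloud file named `0` are the
combination of all the inputs. -/
def Algorithm.SolvesComb {V : Type u} [Fintype V] [Nonempty V] {G : CWC V} {s : ℕ}
    (A : Algorithm G s) (op : Bits s → Bits s → Bits s) [Std.Commutative op] [Std.Associative op]
    (T : ℕ) : Prop :=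
  ∀ (S : V → Bits s) (M : Cell → Bool) (p : Fin s),
    (A.run S M T).cloud (0, (p : ℕ)) = combination op S p

end CloudComputing

/-! Let `N` bound every cluster radius and every quotient `s / b_c(B_i)`; `⌈max 1 Z_max⌉` does.
Choose a maximal family of pairwise disjoint cloud clusters (`exists_schedule`). By maximality every
cluster meets a chosen one, so every node is within `2 * N` hops of a chosen center. Fat links carry
a whole string per round, so all inputs can be merged into the centers in `2 * N` rounds
(`reaches_gather`); commutativity makes the grouping irrelevant.

The centers then combine their values through the cloud. Disjoint clusters do not interfere: in
parallel, each center spreads the bits of its string over its cluster in `N` rounds, and `s ≤ N *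
b_c(B_i)` lets the cluster write them in `N` more; reading is the reverse (`reaches_write`,
`reaches_read`). One such exchange lets about half of the active centers absorb the others
(`reaches_halve`). After `⌈log₂ n⌉` phases one center holds the result and writes it to file `0`.
The total is `O(N log n)`, a logarithm better than required. -/

namespace CloudComputing

open scoped Classical

variable {V : Type u} {G : CWC V} {s : ℕ}

/-! ### Straight-line programs -/

/-- The memory of a processing node: an accumulator and a buffer. -/
structure Regs (s : ℕ) : Type u where
  acc : Bits s
  buf : Bits s

/-- The memories of all nodes and the contents of the cloud. -/
structure Global (V : Type u) (s : ℕ) : Type u where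
  regs : V → Regs.{u} s
  cloud : Cell → Bool

/-- One round in which every node sends one and the same `s`-bit message to all its neighbours. -/
structure Round (G : CWC V) (s : ℕ) where
  message : V → Regs.{u} s → Bits s
  reads : V → Finset Cell
  writes : V → Finset Cell
  value : V → Regs.{u} s → Cell → Bool
  step : V → Regs.{u} s → (V → Bits s) → (Cell → Bool) → Regs.{u} s
  card_reads_le : ∀ i, (reads i).card ≤ G.down i
  card_writes_le : ∀ i, (writes i).card ≤ G.up i
  exclusive : ∀ i j c, c ∈ writes i → c ∈ writes j → i = j

namespace Round

/-- The effect of a round.  Messages that do not arrive and cells that are not read are replaced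
by zeros. -/
noncomputable def exec (K : Global V s) (R : Round G s) : Global V s where
  regs i := R.step i (K.regs i)
    (fun j => if G.Link j i then R.message j (K.regs j) else fun _ => false)
    (fun c => if c ∈ R.reads i then K.cloud c else false)
  cloud c :=
    if h : ∃ i, c ∈ R.writes i then R.value h.choose (K.regs h.choose) c else K.cloud c

lemma exec_cloud_of_mem (R : Round G s) (K : Global V s) {i : V} {c : Cell}
    (h : c ∈ R.writes i) : (exec K R).cloud c = R.value i (K.regs i) c := by
  have h' : ∃ i, c ∈ R.writes i := ⟨i, h⟩
  have e : h'.choose = i := R.exclusive _ _ c h'.choose_spec h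
  simp only [exec, dif_pos h', e]

lemma exec_cloud_of_forall_notMem (R : Round G s) (K : Global V s) {c : Cell}
    (h : ∀ i, c ∉ R.writes i) : (exec K R).cloud c = K.cloud c := by
  have h' : ¬ ∃ i, c ∈ R.writes i := by simpa using h
  simp only [exec, dif_neg h']

/-- A round without communication with the cloud. -/
def exchange (message : V → Regs.{u} s → Bits s)
    (step : V → Regs.{u} s → (V → Bits s) → Regs.{u} s) : Round G s where
  message := message
  reads _ := ∅
  writes _ := ∅
  value _ _ _ := false
  step i σ m _ := step i σ m
  card_reads_le := by simp
  card_writes_le := by simp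
  exclusive := by simp

lemma exec_exchange (message : V → Regs.{u} s → Bits s)
    (step : V → Regs.{u} s → (V → Bits s) → Regs.{u} s) (K : Global V s) :
    exec K (exchange (G := G) message step) =
      ⟨fun i => step i (K.regs i)
        (fun j => if G.Link j i then message j (K.regs j) else fun _ => false), K.cloud⟩ := by
  simp [exec, exchange]

/-- The round in which nothing happens. -/
def idle : Round G s := exchange (fun _ σ => σ.acc) (fun _ σ _ => σ)

end Round

/-- The algorithm that executes a given sequence of rounds. -/
noncomputable def algorithmOfRounds (hfat : ∀ i j, G.Link i j → s ≤ G.w i j)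
    (R : ℕ → Round G s) : Algorithm G s where
  State := Regs.{u} s
  init _ x := ⟨x, x⟩
  send t i _ σ q := if h : (q : ℕ) < s then (R t).message i σ ⟨q, h⟩ else false
  readCells t := (R t).reads
  writeCells t := (R t).writes
  writeValue t := (R t).value
  step t i σ m r := (R t).step i σ
    (fun j => if h : G.Link j i then fun p => m j h (Fin.castLE (hfat j i h) p)
      else fun _ => false)
    (fun c => if h : c ∈ (R t).reads i then r c h else false)
  card_readCells_le t := (R t).card_reads_le
  card_writeCells_le t := (R t).card_writes_le
  exclusive_write t := (R t).exclusive

/-- The memories before the first round. -/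
def Global.start (S : V → Bits s) (M : Cell → Bool) : Global V s := ⟨fun i => ⟨S i, S i⟩, M⟩

lemma run_algorithmOfRounds (hfat : ∀ i j, G.Link i j → s ≤ G.w i j) (l : List (Round G s))
    (S : V → Bits s) (M : Cell → Bool) (T : ℕ) (hT : T ≤ l.length) :
    (algorithmOfRounds hfat (fun t => l.getD t Round.idle)).run S M T =
      ⟨((l.take T).foldl Round.exec (Global.start S M)).regs,
        ((l.take T).foldl Round.exec (Global.start S M)).cloud⟩ := by
  induction T with
  | zero => rfl
  | succ T ih =>
    have hT' : T < l.length := hT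
    have e : l.getD T Round.idle = l[T] := by simp [hT']
    rw [Algorithm.run, ih hT'.le, List.take_succ_eq_append_getElem hT', List.foldl_append]
    generalize (l.take T).foldl Round.exec (Global.start S M) = K
    simp only [List.foldl_cons, List.foldl_nil, Algorithm.next, Round.exec, algorithmOfRounds, e]
    congr 1
    -- Only messages remain to be compared: padding `s` bits to the link's bandwidth and then
    -- keeping the first `s` loses nothing.
    funext i
    congr 1
    funext j
    split_ifs <;> simp

/-- Some program of `T` rounds relates the configurations before and after it by `P`. -/
def Reaches (G : CWC V) (s T : ℕ) (P : Global V s → Global V s → Prop) : Prop :=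
  ∃ l : List (Round G s), l.length = T ∧ ∀ K, P K (l.foldl Round.exec K)

namespace Reaches

variable {T T₁ T₂ : ℕ} {P P₁ P₂ : Global V s → Global V s → Prop}

lemma zero (h : ∀ K, P K K) : Reaches G s 0 P := ⟨[], rfl, h⟩

lemma of_round (R : Round G s) (h : ∀ K, P K (R.exec K)) : Reaches G s 1 P := ⟨[R], rfl, h⟩

lemma comp (h₁ : Reaches G s T₁ P₁) (h₂ : Reaches G s T₂ P₂)
    (h : ∀ K K' K'', P₁ K K' → P₂ K' K'' → P K K'') : Reaches G s (T₁ + T₂) P := by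
  obtain ⟨l₁, rfl, h₁⟩ := h₁
  obtain ⟨l₂, rfl, h₂⟩ := h₂
  refine ⟨l₁ ++ l₂, by simp, fun K => ?_⟩
  rw [List.foldl_append]
  exact h _ _ _ (h₁ K) (h₂ _)

/-- The program is chosen before the configuration, so a single algorithm serves all inputs and all
initial cloud contents. -/
lemma exists_algorithm (hfat : ∀ i j, G.Link i j → s ≤ G.w i j) (h : Reaches G s T P) :
    ∃ A : Algorithm G s, ∀ S M, ∃ K : Global V s, P (Global.start S M) K ∧
      (A.run S M T).cloud = K.cloud := by
  obtain ⟨l, rfl, h⟩ := h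
  refine ⟨algorithmOfRounds hfat (fun t => l.getD t Round.idle), fun S M => ⟨_, h _, ?_⟩⟩
  rw [run_algorithmOfRounds hfat l S M l.length le_rfl, List.take_length]

end Reaches

/-! ### Products of strings -/

/-- The strings, as a semigroup under `op`. -/
def Combo (_op : Bits s → Bits s → Bits s) : Type := Bits s

/-- Since `op` may lack a unit, products are taken in `WithOne` of this semigroup, where the
`Finset.prod` lemmas apply; `lift_injective` leads back to strings. -/
instance (op : Bits s → Bits s → Bits s) [hc : Std.Commutative op] [ha : Std.Associative op] :
    CommSemigroup (Combo op) where
  mul := op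
  mul_assoc := ha.assoc
  mul_comm := hc.comm

section Lift

variable (op : Bits s → Bits s → Bits s)

/-- A string as an element of the monoid obtained from `op` by adjoining a unit. -/
def lift (a : Bits s) : WithOne (Combo op) := WithOne.coe (α := Combo op) a

lemma lift_injective : Function.Injective (lift op) := fun _ _ h => WithOne.coe_injective h

variable [Std.Commutative op] [Std.Associative op]

lemma lift_op (a b : Bits s) : lift op (op a b) = lift op a * lift op b :=
  WithOne.coe_mul (α := Combo op) a b

/-- Nonemptiness keeps the product away from the adjoined unit, so that it fits into a register. -/
lemma exists_lift_eq_prod {ι : Type*} (A : Finset ι) (hA : A.Nonempty) (x : ι → Bits s) :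
    ∃ a, lift op a = ∏ i ∈ A, lift op (x i) := by
  refine Finset.prod_induction_nonempty (fun i => lift op (x i)) (fun y => ∃ a, lift op a = y)
    ?_ hA (fun i _ => ⟨x i, rfl⟩)
  rintro _ _ ⟨a, rfl⟩ ⟨b, rfl⟩
  exact ⟨op a b, lift_op op a b⟩

lemma lift_fold {ι : Type*} (A : Finset ι) (b : Bits s) (x : ι → Bits s) :
    lift op (A.fold op b x) = lift op b * ∏ i ∈ A, lift op (x i) := by
  induction A using Finset.induction_on with
  | empty => simp
  | insert i A hi ih => rw [Finset.fold_insert hi, lift_op, ih, Finset.prod_insert hi, mul_left_comm]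

lemma lift_combination [Fintype V] [Nonempty V] (S : V → Bits s) :
    lift op (combination op S) = ∏ v, lift op (S v) := by
  rw [combination, lift_fold]
  exact Finset.mul_prod_erase Finset.univ (fun v => lift op (S v)) (Finset.mem_univ _)

/-- One round of merging the accumulators of `A` into those of `A'` along local links. -/
lemma reaches_merge (A A' : Finset V) (f : V → V) (hf : ∀ u ∈ A, f u ∈ A')
    (hA : A' ⊆ A) (hid : ∀ u ∈ A', f u = u)
    (hlink : ∀ u ∈ A, f u ≠ u → G.Link u (f u)) :
    Reaches G s 1 fun K K' =>
      ∏ v ∈ A', lift op (K'.regs v).acc = ∏ v ∈ A, lift op (K.regs v).acc := by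
  -- Each fiber over `A'` contains its base point, hence is nonempty.
  have hex : ∀ (v : V) (x : V → Bits s), v ∈ A' →
      ∃ a, lift op a = ∏ u ∈ A.filter (f · = v), lift op (x u) := fun v x hv =>
    exists_lift_eq_prod op (A.filter (f · = v)) ⟨v, Finset.mem_filter.2 ⟨hA hv, hid v hv⟩⟩ x
  let step : V → Regs.{u} s → (V → Bits s) → Regs.{u} s := fun v σ m =>
    if hv : v ∈ A' then ⟨(hex v (fun u => if u = v then σ.acc else m u) hv).choose, σ.buf⟩ else σ
  refine Reaches.of_round (Round.exchange (fun _ σ => σ.acc) step) fun K => ?_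
  rw [Round.exec_exchange, ← Finset.prod_fiberwise_of_maps_to hf]
  refine Finset.prod_congr rfl fun v hv => ?_
  simp only [step, dif_pos hv]
  refine (Exists.choose_spec (hex v _ hv)).trans (Finset.prod_congr rfl fun u hu => ?_)
  obtain ⟨huA, rfl⟩ := Finset.mem_filter.1 hu
  by_cases h : u = f u
  · rw [if_pos h, ← h]
  · rw [if_neg h, if_pos (hlink u huA (Ne.symm h))]

end Lift

/-! ### Communication within disjoint clusters -/

/-- Transport of buffered bits, in parallel for all centers `v` in `A` and all positions `p`, along
routes `π v p` that stay in the cluster of `v`. -/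
lemma reaches_transport (A : Finset V) (center : V → V) (π : V → Fin s → ℕ → V)
    (hcenter : ∀ v ∈ A, ∀ p r, center (π v p r) = v)
    (hlink : ∀ v p r, π v p r ≠ π v p (r + 1) → G.Link (π v p r) (π v p (r + 1))) (T : ℕ) :
    Reaches G s T fun K K' => (∀ v, (K'.regs v).acc = (K.regs v).acc) ∧ K'.cloud = K.cloud ∧
      ∀ v ∈ A, ∀ p, (K'.regs (π v p T)).buf p = (K.regs (π v p 0)).buf p := by
  induction T with
  | zero => exact Reaches.zero fun K => ⟨fun _ => rfl, rfl, fun _ _ _ => rfl⟩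
  | succ T ih =>
    refine ih.comp (P₂ := fun K K' => (∀ v, (K'.regs v).acc = (K.regs v).acc) ∧
      K'.cloud = K.cloud ∧
      ∀ v ∈ A, ∀ p, (K'.regs (π v p (T + 1))).buf p = (K.regs (π v p T)).buf p)
      -- Bit `p` always occupies buffer position `p`, and a node serves only one center. Hence
      -- routes never collide, and one `s`-bit message per link suffices.
      (Reaches.of_round (Round.exchange (fun _ σ => σ.buf) fun u σ m =>
        ⟨σ.acc, fun p => if π (center u) p (T + 1) = u then
          (if π (center u) p T = u then σ.buf p else m (π (center u) p T) p) else σ.buf p⟩)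
        fun K => ?_) ?_
    · rw [Round.exec_exchange]
      refine ⟨fun _ => rfl, rfl, fun v hv p => ?_⟩
      simp only [hcenter v hv, if_true]
      split_ifs with h h'
      · rw [h]
      · rfl
      · exact absurd (hlink v p T h) h'
    · rintro K K' K'' ⟨ha, hc, hb⟩ ⟨ha', hc', hb'⟩
      exact ⟨fun v => (ha' v).trans (ha v), hc'.trans hc,
        fun v hv p => (hb' v hv p).trans (hb v hv p)⟩

/-- A set of centers with disjoint clusters.  Bit `p` of an `s`-bit string of the center `v` is
accessed in the cloud by the node `route v p N`, in the round `slot v p`; this node belongs to the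
cluster of `v`, and the bit is routed to it within the cluster. -/
structure Schedule (G : CWC V) (s N : ℕ) where
  centers : Finset V
  center : V → V
  route : V → Fin s → ℕ → V
  slot : V → Fin s → ℕ
  rank : V → Fin s → ℕ
  center_route : ∀ v ∈ centers, ∀ p r, center (route v p r) = v
  route_zero : ∀ v p, route v p 0 = v
  link_route : ∀ v p r, route v p r ≠ route v p (r + 1) →
    G.Link (route v p r) (route v p (r + 1))
  slot_lt : ∀ v p, slot v p < N
  rank_lt : ∀ v p, rank v p < G.up (route v p N)
  injective : ∀ v p q, route v p N = route v q N → slot v p = slot v q → rank v p = rank v q →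
    p = q

/-! ### Parallel cloud access by disjoint clusters -/

namespace Schedule

variable {N : ℕ} (Φ : Schedule G s N) {t : ℕ} {φ : V → ℕ}

/-- The cells that `u` accesses in round `t`, if the string of each center `v` is in file `φ v`. -/
noncomputable def cells (φ : V → ℕ) (t : ℕ) (u : V) : Finset Cell :=
  (Finset.univ.filter fun p : Fin s => Φ.route (Φ.center u) p N = u ∧ Φ.slot (Φ.center u) p = t).image
    fun p : Fin s => (φ (Φ.center u), (p : ℕ))

/-- For a fixed node and round, `rank` is injective on the accessed positions and takes values below
the bandwidth. -/
lemma card_cells_le (u : V) : (Φ.cells φ t u).card ≤ G.up u := by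
  refine Finset.card_image_le.trans ?_
  rw [← Finset.card_range (G.up u)]
  refine Finset.card_le_card_of_injOn (Φ.rank (Φ.center u)) (fun p hp => ?_)
    fun p hp q hq h => ?_
  · simp only [Finset.coe_filter, Finset.mem_univ, true_and, Set.mem_ofPred_eq] at hp
    have := Φ.rank_lt (Φ.center u) p
    rw [hp.1] at this
    simpa using this
  · simp only [Finset.coe_filter, Finset.mem_univ, true_and, Set.mem_ofPred_eq] at hp hq
    exact Φ.injective _ p q (hp.1.trans hq.1.symm) (hp.2.trans hq.2.symm) h

lemma mem_cells {v : V} (hv : v ∈ Φ.centers) (p : Fin s) :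
    (φ v, (p : ℕ)) ∈ Φ.cells φ (Φ.slot v p) (Φ.route v p N) := by
  simp only [cells, Finset.mem_image, Finset.mem_filter, Finset.mem_univ, true_and]
  exact ⟨p, by simp [Φ.center_route v hv]⟩

/-- The file name determines the center, and center and position together determine the accessing
node and the round. -/
lemma eq_of_mem_cells (hφ : Function.Injective φ) {u v : V} {p : Fin s}
    (h : (φ v, (p : ℕ)) ∈ Φ.cells φ t u) : u = Φ.route v p N ∧ Φ.slot v p = t := by
  simp only [cells, Finset.mem_image, Finset.mem_filter, Finset.mem_univ, true_and,
    Prod.mk.injEq] at h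
  obtain ⟨q, ⟨h1, h2⟩, h3, h4⟩ := h
  obtain rfl := Fin.ext h4
  obtain rfl := hφ h3
  exact ⟨h1.symm, h2⟩

lemma exclusive_cells (hφ : Function.Injective φ) (i j : V) (c : Cell)
    (hi : c ∈ Φ.cells φ t i) (hj : c ∈ Φ.cells φ t j) : i = j := by
  have hi' := hi
  simp only [cells, Finset.mem_image, Finset.mem_filter, Finset.mem_univ, true_and] at hi'
  obtain ⟨p, -, rfl⟩ := hi'
  exact (Φ.eq_of_mem_cells hφ hi).1.trans (Φ.eq_of_mem_cells hφ hj).1.symm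

/-- Writing the buffered bits to the cloud. -/
lemma reaches_store (hφ : Function.Injective φ) (T : ℕ) :
    Reaches G s T fun K K' => K'.regs = K.regs ∧ ∀ v ∈ Φ.centers, ∀ p, Φ.slot v p < T →
      K'.cloud (φ v, (p : ℕ)) = (K.regs (Φ.route v p N)).buf p := by
  induction T with
  | zero => exact Reaches.zero fun K => ⟨rfl, by simp⟩
  | succ T ih =>
    let R : Round G s :=
      { message := fun _ σ => σ.buf
        reads := fun _ => ∅
        writes := Φ.cells φ T
        value := fun _ σ c => if h : c.2 < s then σ.buf ⟨c.2, h⟩ else false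
        step := fun _ σ _ _ => σ
        card_reads_le := by simp
        card_writes_le := Φ.card_cells_le
        exclusive := Φ.exclusive_cells hφ }
    refine ih.comp (P₂ := fun K K' => K' = R.exec K) (Reaches.of_round R fun K => rfl) ?_
    rintro K K' _ ⟨hr, hc⟩ rfl
    refine ⟨hr, fun v hv p hp => ?_⟩
    by_cases h : Φ.slot v p = T
    · rw [R.exec_cloud_of_mem K' (i := Φ.route v p N) (show _ ∈ Φ.cells φ T _ from h ▸ Φ.mem_cells hv p), hr]
      simp [R]
    · rw [R.exec_cloud_of_forall_notMem K' fun i hi => h (Φ.eq_of_mem_cells hφ hi).2]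
      exact hc v hv p (by omega)

/-- Reading bits from the cloud into the buffers. -/
lemma reaches_fetch (hcloud : ∀ i, G.up i = G.down i) (φ : V → ℕ) (T : ℕ) :
    Reaches G s T fun K K' => (∀ v, (K'.regs v).acc = (K.regs v).acc) ∧ K'.cloud = K.cloud ∧
      ∀ v ∈ Φ.centers, ∀ p, Φ.slot v p < T →
        (K'.regs (Φ.route v p N)).buf p = K.cloud (φ v, (p : ℕ)) := by
  induction T with
  | zero => exact Reaches.zero fun K => ⟨fun _ => rfl, rfl, by simp⟩
  | succ T ih =>
    let R : Round G s :=
      { message := fun _ σ => σ.buf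
        reads := Φ.cells φ T
        writes := fun _ => ∅
        value := fun _ _ _ => false
        step := fun u σ _ r => ⟨σ.acc, fun p =>
          if Φ.slot (Φ.center u) p = T then r (φ (Φ.center u), (p : ℕ)) else σ.buf p⟩
        card_reads_le := fun i => (Φ.card_cells_le i).trans (hcloud i).le
        card_writes_le := by simp
        exclusive := by simp }
    refine ih.comp (P₂ := fun K K' => K' = R.exec K) (Reaches.of_round R fun K => rfl) ?_
    rintro K K' _ ⟨ha, hc, hb⟩ rfl
    refine ⟨ha, ?_, fun v hv p hp => ?_⟩
    · funext c
      rw [R.exec_cloud_of_forall_notMem K' (by simp [R]), hc]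
    · have hm := Φ.mem_cells (φ := φ) hv p
      simp only [Round.exec, R, Φ.center_route v hv]
      by_cases h : Φ.slot v p = T
      · rw [if_pos h, if_pos (h ▸ hm), hc]
      · rw [if_neg h]
        exact hb v hv p (by omega)

/-- Every center `v` writes its accumulator to the file `φ v`. -/
lemma reaches_write (hφ : Function.Injective φ) :
    Reaches G s (1 + N + N) fun K K' => (∀ v, (K'.regs v).acc = (K.regs v).acc) ∧
      ∀ v ∈ Φ.centers, ∀ p : Fin s, K'.cloud (φ v, (p : ℕ)) = (K.regs v).acc p := by
  have h₁ : Reaches G s 1 fun K K' : Global V s => (∀ v, (K'.regs v).acc = (K.regs v).acc) ∧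
      ∀ v, (K'.regs v).buf = (K.regs v).acc :=
    Reaches.of_round (Round.exchange (fun _ σ => σ.acc) fun _ σ _ => ⟨σ.acc, σ.acc⟩) fun K => by
      simp [Round.exec_exchange]
  have h₂ := h₁.comp (reaches_transport Φ.centers Φ.center Φ.route Φ.center_route Φ.link_route N)
    (P := fun K K' => (∀ v, (K'.regs v).acc = (K.regs v).acc) ∧
      ∀ v ∈ Φ.centers, ∀ p, (K'.regs (Φ.route v p N)).buf p = (K.regs v).acc p) (by
      rintro K K' K'' ⟨ha, hb⟩ ⟨ha', -, hb'⟩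
      refine ⟨fun v => (ha' v).trans (ha v), fun v hv p => ?_⟩
      rw [hb' v hv p, Φ.route_zero, hb])
  refine h₂.comp (Φ.reaches_store hφ N) ?_
  rintro K K' K'' ⟨ha, hb⟩ ⟨hr, hc⟩
  refine ⟨fun v => by rw [hr, ha], fun v hv p => ?_⟩
  rw [hc v hv p (Φ.slot_lt v p), hb v hv p]

/-- Every center `v` reads the file `φ v` into its buffer. -/
lemma reaches_read (hG : ∀ i j, G.Link i j → G.Link j i) (hcloud : ∀ i, G.up i = G.down i)
    (φ : V → ℕ) :
    Reaches G s (N + N) fun K K' => (∀ v, (K'.regs v).acc = (K.regs v).acc) ∧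
      ∀ v ∈ Φ.centers, ∀ p : Fin s, (K'.regs v).buf p = K.cloud (φ v, (p : ℕ)) := by
  refine (Φ.reaches_fetch hcloud φ N).comp (reaches_transport Φ.centers Φ.center
    -- The routes are run backwards, which symmetric links allow.
    (fun v p r => Φ.route v p (N - r)) (fun v hv p r => Φ.center_route v hv p _) ?_ N) ?_
  · intro v p r h
    rcases le_or_gt N r with hr | hr
    · exact absurd (by rw [Nat.sub_eq_zero_of_le hr, Nat.sub_eq_zero_of_le (hr.trans r.le_succ)]) h
    · obtain ⟨m, hm⟩ : ∃ m, N - r = m + 1 := ⟨N - r - 1, by omega⟩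
      have hm' : N - (r + 1) = m := by omega
      rw [hm, hm'] at h ⊢
      exact hG _ _ (Φ.link_route v p m h.symm)
  · rintro K K' K'' ⟨ha, -, hb⟩ ⟨ha', -, hb'⟩
    refine ⟨fun v => (ha' v).trans (ha v), fun v hv p => ?_⟩
    have := hb' v hv p
    rw [Nat.sub_self, Φ.route_zero, Nat.sub_zero] at this
    rw [this, hb v hv p (Φ.slot_lt v p)]

/-! ### Combining the centers by repeated halving -/

section Combine

variable (op : Bits s → Bits s → Bits s) [Std.Commutative op] [Std.Associative op]

/-- Halving the number of active centers: every `v` in `B` merges the value of `g v`. -/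
lemma reaches_halve [Finite V] (hG : ∀ i j, G.Link i j → G.Link j i)
    (hcloud : ∀ i, G.up i = G.down i) (A B : Finset V) (hA : A ⊆ Φ.centers) (hB : B ⊆ A)
    (g : V → V) (hg : Set.InjOn g B) (hgA : ∀ v ∈ B, g v ∈ Φ.centers) :
    Reaches G s (4 * N + 2) fun K K' => ∏ v ∈ A, lift op (K'.regs v).acc =
      (∏ v ∈ A, lift op (K.regs v).acc) * ∏ v ∈ B.image g, lift op (K.regs v).acc := by
  obtain ⟨φ, hφ⟩ : ∃ φ : V → ℕ, Function.Injective φ := Countable.exists_injective_nat V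
  have h := (Φ.reaches_write hφ).comp (Φ.reaches_read hG hcloud fun v => φ (g v))
    (P := fun K K' => (∀ v, (K'.regs v).acc = (K.regs v).acc) ∧
      ∀ v ∈ B, (K'.regs v).buf = (K.regs (g v)).acc) (by
      rintro K K' K'' ⟨ha, hc⟩ ⟨ha', hb⟩
      refine ⟨fun v => (ha' v).trans (ha v), fun v hv => funext fun p => ?_⟩
      rw [hb v (hA (hB hv)) p, hc _ (hgA v hv) p])
  have h' := h.comp (Reaches.of_round (P := fun K K' => ∀ v, (K'.regs v).acc =
      if v ∈ B then op (K.regs v).acc (K.regs v).buf else (K.regs v).acc)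
    (Round.exchange (G := G) (fun _ σ => σ.acc) fun v σ _ =>
      ⟨if v ∈ B then op σ.acc σ.buf else σ.acc, σ.buf⟩) fun K v => by simp [Round.exec_exchange])
    (P := fun K K' => ∏ v ∈ A, lift op (K'.regs v).acc =
      (∏ v ∈ A, lift op (K.regs v).acc) * ∏ v ∈ B.image g, lift op (K.regs v).acc) (by
      rintro K K' K'' ⟨ha, hb⟩ h
      rw [Finset.prod_image hg, ← Finset.inter_eq_right.2 hB, ← Finset.prod_ite_mem,
        ← Finset.prod_mul_distrib]
      refine Finset.prod_congr rfl fun v _ => ?_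
      rw [h v]
      split_ifs with hv
      · rw [lift_op, ha, hb v hv]
      · rw [mul_one, ha])
  convert h' using 1
  ring

/-- The values of at most `2 ^ m` centers are combined at one center. -/
lemma exists_reaches_combine [Finite V] (hG : ∀ i j, G.Link i j → G.Link j i)
    (hcloud : ∀ i, G.up i = G.down i) (m : ℕ) (A : Finset V) (hA : A ⊆ Φ.centers)
    (hne : A.Nonempty) (hcard : A.card ≤ 2 ^ m) :
    ∃ v ∈ Φ.centers, Reaches G s (m * (4 * N + 2)) fun K K' =>
      lift op (K'.regs v).acc = ∏ v ∈ A, lift op (K.regs v).acc := by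
  induction m generalizing A with
  | zero =>
    obtain ⟨v, rfl⟩ := Finset.card_eq_one.1 (le_antisymm (by simpa using hcard) hne.card_pos)
    exact ⟨v, hA (by simp), by simpa using Reaches.zero (by simp)⟩
  | succ m ih =>
    -- Rounding up makes `A'` at least as large as its complement in `A`, so each discarded center
    -- gets its own absorber in `B ⊆ A'`.
    obtain ⟨A', hA', hA'card⟩ := Finset.exists_subset_card_eq (s := A) (n := (A.card + 1) / 2)
      (by omega)
    have hpos := hne.card_pos
    have hsd := Finset.card_sdiff_add_card_eq_card hA'
    obtain ⟨B, hB, hBcard⟩ := Finset.exists_subset_card_eq (s := A') (n := (A \ A').card)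
      (by omega)
    obtain ⟨v, hv, h⟩ := ih A' (hA'.trans hA) (Finset.card_pos.1 (by omega))
      (by rw [pow_succ] at hcard; omega)
    let e := Finset.equivOfCardEq hBcard
    let g : V → V := fun v => if hv : v ∈ B then e ⟨v, hv⟩ else v
    have hgB : ∀ x (hx : x ∈ B), g x = e ⟨x, hx⟩ := fun x hx => dif_pos hx
    have hg : Set.InjOn g B := by
      intro x hx y hy hxy
      rw [hgB x hx, hgB y hy] at hxy
      simpa using e.injective (Subtype.ext hxy)
    have himage : B.image g = A \ A' := by
      refine Finset.eq_of_subset_of_card_le (fun y hy => ?_) ?_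
      · obtain ⟨x, hx, rfl⟩ := Finset.mem_image.1 hy
        rw [hgB x hx]
        exact (e _).2
      · rw [Finset.card_image_of_injOn hg, hBcard]
    have hgA : ∀ x ∈ B, g x ∈ Φ.centers := fun x hx =>
      hA (Finset.sdiff_subset (himage ▸ Finset.mem_image_of_mem g hx))
    refine ⟨v, hv, ?_⟩
    have := (Φ.reaches_halve op hG hcloud A' B (hA'.trans hA) hB g hg hgA).comp h
      (P := fun K K' => lift op (K'.regs v).acc = ∏ v ∈ A, lift op (K.regs v).acc) (by
        intro K K' K'' h1 h2
        rw [h2, h1, himage, mul_comm, Finset.prod_sdiff hA'])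
    convert this using 1
    ring

end Combine

end Schedule

/-! ### Cloud clusters -/

lemma CWC.FatLinks.link_of_adj (hG : G.FatLinks s) {u v : V} (h : G.localGraph.Adj u v) :
    G.Link u v :=
  ((SimpleGraph.fromRel_adj _ _ _).1 h).2.elim id (hG.link_symm _ _)

lemma CWC.exists_walk_of_edist_le {u v : V} {k : ℕ} (h : G.localGraph.edist u v ≤ k) :
    ∃ w : G.localGraph.Walk u v, w.length ≤ k := by
  obtain ⟨w, hw⟩ := SimpleGraph.exists_walk_of_edist_ne_top
    (ne_top_of_le_ne_top (ENat.natCast_ne_top k) h)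
  exact ⟨w, by rw [← hw] at h; exact_mod_cast h⟩

/-- The positions of a string can be distributed over the nodes of `B` and `N` rounds. -/
lemma exists_slots {N : ℕ} {B : Finset V} (h : s ≤ N * G.cloudBandwidth B) :
    ∃ (o : Fin s → V) (slot rank : Fin s → ℕ), (∀ p, o p ∈ B) ∧ (∀ p, slot p < N) ∧
      (∀ p, rank p < G.up (o p)) ∧
      ∀ p q, o p = o q → slot p = slot q → rank p = rank q → p = q := by
  -- Triples of a node of `B`, a rank below its bandwidth and a slot below `N` number `N * b_c(B) ≥
  -- s`.
  obtain ⟨e⟩ : Nonempty (Fin s ↪ (u : B) × (Fin (G.up u) × Fin N)) := by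
    refine Function.Embedding.nonempty_of_card_le ?_
    simp only [Fintype.card_sigma, Fintype.card_prod, Fintype.card_fin, ← Finset.sum_mul]
    rw [Finset.sum_coe_sort B G.up, mul_comm]
    exact h
  refine ⟨fun p => (e p).1, fun p => (e p).2.2, fun p => (e p).2.1, fun p => (e p).1.2,
    fun p => (e p).2.2.2, fun p => (e p).2.1.2, fun p q h1 h2 h3 => e.injective ?_⟩
  dsimp only at h1 h2 h3
  generalize e p = x at h1 h2 h3 ⊢
  generalize e q = y at h1 h2 h3 ⊢
  obtain ⟨⟨x, hx⟩, x1, x2⟩ := x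
  obtain ⟨⟨y, hy⟩, y1, y2⟩ := y
  obtain rfl : x = y := h1
  obtain rfl := Fin.ext h2
  obtain rfl := Fin.ext h3
  rfl

section Finite

variable [Fintype V]

lemma CWC.mem_ball {i j : V} {r : ℕ} : j ∈ G.ball i r ↔ G.localGraph.edist i j ≤ r := by
  simp [CWC.ball]

/-- Within `D` rounds, the accumulators of all nodes at most `D` hops away from `A` are combined
into those of the nodes of `A`. -/
lemma reaches_gather (hG : G.FatLinks s) (op : Bits s → Bits s → Bits s) [Std.Commutative op]
    [Std.Associative op] (A : Finset V) (D : ℕ) :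
    Reaches G s D fun K K' => ∏ v ∈ A, lift op (K'.regs v).acc =
      ∏ v with ∃ c ∈ A, G.localGraph.edist v c ≤ D, lift op (K.regs v).acc := by
  induction D with
  | zero => exact Reaches.zero fun K => by simp [SimpleGraph.edist_eq_zero_iff]
  | succ D ih =>
    have hstep : ∀ u : V, (∃ c ∈ A, G.localGraph.edist u c ≤ (D + 1 : ℕ)) →
        ∃ x, (x = u ∨ G.Link u x) ∧ ∃ c ∈ A, G.localGraph.edist x c ≤ D := by
      rintro u ⟨c, hc, h⟩
      obtain ⟨w, hw⟩ := CWC.exists_walk_of_edist_le h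
      cases w with
      | nil => exact ⟨u, .inl rfl, u, hc, by simp⟩
      | cons hadj w =>
        refine ⟨_, .inr (hG.link_of_adj hadj), c, hc, (SimpleGraph.edist_le w).trans ?_⟩
        rw [SimpleGraph.Walk.length_cons] at hw
        exact_mod_cast Nat.le_of_succ_le_succ hw
    choose! next hnext hmem using hstep
    let f : V → V := fun u => if ∃ c ∈ A, G.localGraph.edist u c ≤ D then u else next u
    -- The outermost layer moves first: one merge along `f` reduces distance `D + 1` to distance
    -- `D`.
    rw [add_comm]
    refine (reaches_merge op (Finset.univ.filter fun v => ∃ c ∈ A, G.localGraph.edist v c ≤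
      (D + 1 : ℕ)) (Finset.univ.filter fun v => ∃ c ∈ A, G.localGraph.edist v c ≤ D) f
      ?_ ?_ ?_ ?_).comp ih fun K K' K'' h h' => ?_
    · intro u hu
      simp only [Finset.mem_filter, Finset.mem_univ, true_and] at hu ⊢
      by_cases h : ∃ c ∈ A, G.localGraph.edist u c ≤ D
      · rwa [show f u = u from if_pos h]
      · rw [show f u = next u from if_neg h]
        exact hmem u hu
    · intro u hu
      simp only [Finset.mem_filter, Finset.mem_univ, true_and] at hu ⊢
      obtain ⟨c, hc, h⟩ := hu
      exact ⟨c, hc, h.trans (by exact_mod_cast D.le_succ)⟩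
    · intro u hu
      exact if_pos (by simpa using hu)
    · intro u hu hne
      by_cases h : ∃ c ∈ A, G.localGraph.edist u c ≤ D
      · exact absurd (if_pos h) hne
      · have e : f u = next u := if_neg h
        rw [e] at hne ⊢
        exact (hnext u (by simpa using hu)).resolve_left hne
    · rw [h', h, add_comm 1 D]

lemma CWC.mem_cloudCluster_self (i : V) : i ∈ G.cloudCluster s i := by
  simp [CWC.cloudCluster, CWC.mem_ball]

/-- A maximal family of disjoint cloud clusters yields a schedule. -/
lemma exists_schedule [Nonempty V] (hG : G.FatLinks s) {N : ℕ} (hN : ∀ i, G.cloudRadius s i ≤ N)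
    (hs : ∀ i, s ≤ N * G.cloudBandwidth (G.cloudCluster s i)) :
    ∃ Φ : Schedule G s N, Φ.centers.Nonempty ∧
      ∀ u, ∃ c ∈ Φ.centers, G.localGraph.edist u c ≤ (2 * N : ℕ) := by
  -- With a constant size function, Vitali covering is just the existence of a maximal disjoint
  -- subfamily.
  obtain ⟨A, -, hdisj, hcov⟩ := Vitali.exists_disjoint_subfamily_covering_enlargement
    (fun v => (G.cloudCluster s v : Set V)) Set.univ (fun _ => 1) 2 one_lt_two (by simp) 1
    (by simp) fun v _ => ⟨v, CWC.mem_cloudCluster_self v⟩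
  choose o slot rank ho hslot hrank hinj using fun v => exists_slots (hs v)
  choose w hw using fun v p => CWC.exists_walk_of_edist_le (CWC.mem_ball.1 (ho v p))
  have hroute : ∀ v p r, (w v p).getVert r ∈ G.cloudCluster s v := fun v p r => by
    refine CWC.mem_ball.2 ((SimpleGraph.edist_le ((w v p).take r)).trans ?_)
    have := hw v p
    have h : ((w v p).take r).length ≤ G.cloudRadius s v := by
      rw [SimpleGraph.Walk.take_length]
      omega
    exact_mod_cast h
  have hend : ∀ v p, (w v p).getVert N = o v p := fun v p =>
    (w v p).getVert_of_length_le ((hw v p).trans (hN v))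
  have hcenter : ∃ center : V → V, ∀ v ∈ A, ∀ u ∈ G.cloudCluster s v, center u = v := by
    refine ⟨fun u => if h : ∃ v ∈ A, u ∈ G.cloudCluster s v then h.choose else u,
      fun v hv u hu => ?_⟩
    have h : ∃ v ∈ A, u ∈ G.cloudCluster s v := ⟨v, hv, hu⟩
    refine (dif_pos h).trans ?_
    by_contra hne
    exact Set.disjoint_left.1 (hdisj h.choose_spec.1 hv hne) h.choose_spec.2 hu
  obtain ⟨center, hcenter⟩ := hcenter
  refine ⟨
    { centers := A.toFinset
      center := center
      route := fun v p r => (w v p).getVert r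
      slot := slot
      rank := rank
      center_route := fun v hv p r => hcenter v (by simpa using hv) _ (hroute v p r)
      route_zero := fun v p => (w v p).getVert_zero
      link_route := fun v p r h => ?_
      slot_lt := hslot
      rank_lt := fun v p => by rw [hend]; exact hrank v p
      injective := fun v p q h => hinj v p q (by rwa [hend, hend] at h) }, ?_, fun u => ?_⟩
  · rcases lt_or_ge r (w v p).length with hr | hr
    · exact hG.link_of_adj ((w v p).adj_getVert_succ hr)
    · refine absurd ?_ h
      rw [(w v p).getVert_of_length_le hr, (w v p).getVert_of_length_le (hr.trans r.le_succ)]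
  · obtain ⟨c, hc, -⟩ := hcov (Classical.arbitrary V) trivial
    exact ⟨c, by simpa using hc⟩
  · obtain ⟨c, hc, ⟨x, hx, hx'⟩, -⟩ := hcov u trivial
    refine ⟨c, by simpa using hc, SimpleGraph.edist_triangle.trans
      ((add_le_add (CWC.mem_ball.1 hx) (SimpleGraph.edist_comm.trans_le
        (CWC.mem_ball.1 hx'))).trans ?_)⟩
    have := hN u
    have := hN c
    have h : G.cloudRadius s u + G.cloudRadius s c ≤ 2 * N := by omega
    exact_mod_cast h

/-- `cComb` is solved in `O(N log n)` rounds if `N` bounds all radii and writing times of the cloud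
clusters. -/
lemma exists_solvesComb [Nonempty V] (hG : G.FatLinks s) (op : Bits s → Bits s → Bits s)
    [Std.Commutative op] [Std.Associative op] {N : ℕ} (hN : ∀ i, G.cloudRadius s i ≤ N)
    (hs : ∀ i, s ≤ N * G.cloudBandwidth (G.cloudCluster s i)) :
    ∃ A : Algorithm G s, A.SolvesComb op
      (2 * N + (Nat.clog 2 (Fintype.card V) * (4 * N + 2) + (1 + N + N))) := by
  obtain ⟨Φ, hne, hcov⟩ := exists_schedule hG hN hs
  obtain ⟨v, hv, hcomb⟩ := Φ.exists_reaches_combine op hG.link_symm hG.cloud_symm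
    (Nat.clog 2 (Fintype.card V)) Φ.centers subset_rfl hne
    ((Finset.card_le_univ _).trans (Nat.le_pow_clog one_lt_two _))
  obtain ⟨ν, hν⟩ : ∃ ν : V → ℕ, Function.Injective ν := Countable.exists_injective_nat V
  -- The surviving center must write to the output file `0`; all others are kept off it.
  let φ : V → ℕ := fun u => if u = v then 0 else ν u + 1
  have hφ : Function.Injective φ := by
    intro x y hxy
    by_cases hx : x = v <;> by_cases hy : y = v <;> simp [φ, hx, hy] at hxy ⊢
    exact hν hxy
  have hφv : φ v = 0 := if_pos rfl
  have hfinal := hcomb.comp (Φ.reaches_write hφ) (P := fun K K' =>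
    ∀ x, lift op x = ∏ v ∈ Φ.centers, lift op (K.regs v).acc →
      ∀ p : Fin s, K'.cloud (0, (p : ℕ)) = x p) (by
    rintro K K' K'' h ⟨-, hc⟩ x hx p
    rw [← hφv, hc v hv p, lift_injective op (h.trans hx.symm)])
  have hall := (reaches_gather hG op Φ.centers (2 * N)).comp hfinal (P := fun K K' =>
    ∀ x, lift op x = ∏ v, lift op (K.regs v).acc →
      ∀ p : Fin s, K'.cloud (0, (p : ℕ)) = x p) (by
    intro K K' K'' h h' x hx
    refine h' x (hx.trans ?_)
    rw [h, Finset.filter_true_of_mem fun u _ => hcov u])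
  obtain ⟨A, hA⟩ := hall.exists_algorithm hG.fat
  refine ⟨A, fun S M p => ?_⟩
  obtain ⟨K, hK, hcloud⟩ := hA S M
  rw [hcloud]
  exact hK _ (lift_combination op S) p

/-! ### The timespan -/

/-- Excludes the convention `s / 0 = 0`, under which the timespan would not bound the writing time.
A radius equal to the diameter reaches a node with cloud access; otherwise `0 < s ≤ (k + 1) * b_c`
forces positivity. -/
lemma CWC.CloudReachable.cloudBandwidth_pos (hG : G.CloudReachable) (hs : 0 < s) (i : V) :
    0 < G.cloudBandwidth (G.cloudCluster s i) := by
  obtain ⟨j, hij, hj⟩ := hG i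
  have hpos : ∀ {k : ℕ}, G.localGraph.edist i j ≤ k → 0 < G.cloudBandwidth (G.ball i k) :=
    fun h => hj.trans_le (Finset.single_le_sum (fun _ _ => Nat.zero_le _) (CWC.mem_ball.2 h))
  obtain ⟨w, hw⟩ := SimpleGraph.exists_walk_of_edist_ne_top
    (SimpleGraph.edist_ne_top_iff_reachable.2 hij)
  -- At `k = s + w.length` the ball contains `j`, so its bandwidth is at least `1`, while `k + 1 ≥
  -- s`. Thus the infimum is attained.
  have hmem := Nat.sInf_mem (s := {k : ℕ | (k : ℕ∞) = G.localGraph.ediam} ∪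
    {k : ℕ | s ≤ (k + 1) * G.cloudBandwidth (G.ball i k)}) ⟨s + w.length, .inr (by
      have := hpos (k := s + w.length) (hw ▸ by exact_mod_cast Nat.le_add_left _ _)
      show s ≤ _
      nlinarith)⟩
  rcases hmem with h | h
  · exact hpos (SimpleGraph.edist_le_ediam.trans_eq (Eq.symm h))
  · exact Nat.pos_of_ne_zero fun h0 => by
      have h' : s ≤ _ * G.cloudBandwidth (G.cloudCluster s i) := h
      rw [h0] at h'
      omega

lemma CWC.timespan_le_maxTimespan (i : V) : G.timespan s i ≤ G.maxTimespan s :=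
  le_ciSup (Set.finite_range fun i => G.timespan s i).bddAbove i

end Finite

end CloudComputing

/-! ### The numerical bound -/

theorem mainTheorem1 :
    ∃ C : ℝ, 0 < C ∧
      ∀ (V : Type u) [Fintype V] [Nonempty V] (G : CloudComputing.CWC V) (s : ℕ),
        G.FatLinks s → G.CloudReachable →
        ∀ (op : CloudComputing.Bits s → CloudComputing.Bits s → CloudComputing.Bits s)
          [Std.Commutative op] [Std.Associative op],
          ∃ (T : ℕ) (A : CloudComputing.Algorithm G s),
            A.SolvesComb op T ∧
            (T : ℝ) ≤ C * max 1 (G.maxTimespan s) *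
              (max 1 (Real.logb 2 (Fintype.card V : ℝ))) ^ 2 := by
  -- From `N ≤ 2 * Z` and `clog ≤ 2 * L`, the count is at most `9 * Z + 20 * Z * L`; `34` leaves
  -- slack.
  refine ⟨34, by norm_num, fun V _ _ G s hG hreach op _ _ => ?_⟩
  set Z := max 1 (G.maxTimespan s) with hZ
  set L := max 1 (Real.logb 2 (Fintype.card V : ℝ)) with hL
  have hZ1 : 1 ≤ Z := le_max_left _ _
  have hL1 : 1 ≤ L := le_max_left _ _
  have htime : ∀ i, G.timespan s i ≤ ⌈Z⌉₊ := fun i =>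
    ((CloudComputing.CWC.timespan_le_maxTimespan i).trans (le_max_right _ _)).trans (Nat.le_ceil Z)
  have hN : ∀ i, G.cloudRadius s i ≤ ⌈Z⌉₊ := fun i => by
    have h : (G.cloudRadius s i : ℝ) ≤ G.timespan s i := le_add_of_nonneg_right (by positivity)
    exact_mod_cast h.trans (htime i)
  have hs : ∀ i, s ≤ ⌈Z⌉₊ * G.cloudBandwidth (G.cloudCluster s i) := fun i => by
    rcases Nat.eq_zero_or_pos s with rfl | hpos
    · exact Nat.zero_le _
    have h : (s : ℝ) / G.cloudBandwidth (G.cloudCluster s i) ≤ ⌈Z⌉₊ :=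
      (le_add_of_nonneg_left (Nat.cast_nonneg _)).trans (htime i)
    rw [div_le_iff₀ (by exact_mod_cast hreach.cloudBandwidth_pos hpos i)] at h
    exact_mod_cast h
  obtain ⟨A, hA⟩ := CloudComputing.exists_solvesComb hG op hN hs
  refine ⟨_, A, hA, ?_⟩
  have hceil : (⌈Z⌉₊ : ℝ) ≤ 2 * Z :=
    (Nat.ceil_lt_add_one (by linarith)).le.trans (by linarith)
  have hclog : (Nat.clog 2 (Fintype.card V) : ℝ) ≤ 2 * L := by
    rw [← Real.natCeil_logb_natCast 2]
    have h0 : 0 ≤ Real.logb 2 (Fintype.card V : ℝ) :=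
      Real.logb_nonneg one_lt_two (by exact_mod_cast Fintype.card_pos (α := V))
    have := (Nat.ceil_lt_add_one h0).le
    have := le_max_right 1 (Real.logb 2 (Fintype.card V : ℝ))
    push_cast
    linarith
  push_cast
  have h1 : (Nat.clog 2 (Fintype.card V) : ℝ) * (4 * ⌈Z⌉₊ + 2) ≤ 2 * L * (10 * Z) :=
    mul_le_mul hclog (by linarith) (by positivity) (by linarith)
  -- Only one factor `L` is needed; the square comes from `1 ≤ L`.
  have h2 : Z * L ≤ Z * L ^ 2 :=
    mul_le_mul_of_nonneg_left (by nlinarith) (by linarith)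
  have h3 : Z ≤ Z * L := le_mul_of_one_le_right (by linarith) hL1
  nlinarith
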